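/- For $x\in\mathbb{R}$ let $\|x\|:=\min_{p\in\mathbb{Z}}|x-p|$ be the distance from $x$ to the nearest integer, and for real $\gamma>0$ and $\tau\ge 1$ let $$D_{\gamma,\tau}:=\Bigl\{\alpha\in(0,1)\;:\;\|q\alpha\|\ge\frac{\gamma}{q^{\tau}}\ \text{ for all integers } q\ge 1\Bigr\}.$$ Call a set $E\subset\mathbb{R}$ perfect if it equals the set of its accumulation points, and call $E$ a Cantor set if it is closed, totally disconnected and perfect (so the empty set, which is $D_{\gamma,\tau}$ for every $\gamma\ge\frac12$, counts as a Cantor set). **Theorem.** Let $\tau>\frac{3+\sqrt{17}}{2}$. Then for Lebesgue-almost every $\gamma>0$ the set $D_{\gamma,\tau}$ is a Cantor set. Equivalently, the set of $\gamma>0$ for which $D_{\gamma,\tau}$ has an isolated point has Lebesgue measure zero. -/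

import Mathlib

open Set Filter Topology MeasureTheory

/-- The distance `‖x‖ = inf_{p ∈ ℤ} |x - p|` from `x` to the nearest integer. -/
noncomputable def distNearestInt (x : ℝ) : ℝ := ⨅ p : ℤ, |x - p|

/-- The infimum defining `distNearestInt` is a minimum, attained at `round x`. -/
theorem distNearestInt_eq (x : ℝ) : distNearestInt x = |x - round x| :=
  le_antisymm (ciInf_le ⟨0, by rintro _ ⟨p, rfl⟩; exact abs_nonneg _⟩ (round x))
    (le_ciInf fun p => round_le x p)

/-- The Diophantine set `D_{γ,τ} ⊆ (0,1)`; here `q` runs over the positive integers. -/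
def diophantineSet (γ τ : ℝ) : Set ℝ :=
  {α | α ∈ Ioo (0 : ℝ) 1 ∧ ∀ q : ℕ, 1 ≤ q → γ / (q : ℝ) ^ τ ≤ distNearestInt (q * α)}

/-- A set of reals is perfect if it equals the set of its accumulation points. -/
def IsPerfectSet (E : Set ℝ) : Prop := derivedSet E = E

/-- A Cantor set: closed, totally disconnected and perfect. -/
structure IsCantorSet (E : Set ℝ) : Prop where
  isClosed : IsClosed E
  isTotallyDisconnected : IsTotallyDisconnected E
  isPerfectSet : IsPerfectSet E

/-- The set of isolated points of a set of reals. -/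
def isolatedPoints (E : Set ℝ) : Set ℝ := {x | x ∈ E ∧ ∃ U : Set ℝ, IsOpen U ∧ U ∩ E = {x}}

/-!
For `γ > 0` the set `D = diophantineSet γ τ` is what remains of `(0, 1)` after removing the open
intervals of radius `γ / q ^ (τ + 1)` around all fractions `p / q`. It is closed and contains no
rational number, so it is totally disconnected, and it is a Cantor set as soon as it has no isolated
point (`isCantorSet_diophantineSet`). It is empty for `γ ≥ 1 / 2`.

Let `α` be an isolated point of `D`. If `α` is an endpoint of a removed interval on both sides, then
`γ` solves one of countably many nondegenerate linear equations (`countable_touchingSet`). Otherwise,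
after the reflection `α ↦ 1 - α` if necessary, `α` is not the right endpoint of an interval, and the
right endpoints `e q` of the best intervals with denominator `q` centred below `α` accumulate at `α`
from the left. Let `q < s` be consecutive records of the sequence `e`. Then `(e q, α)` is covered by
intervals with denominators at least `s`, and comparing lengths gives, with a constant `C`,
`α - e q ≤ C * s ^ (1/4 - τ)` (`gap_le`). Since two distinct fractions with denominators `q`, `s`
differ by at least `1 / (q * s)`, this implies `s ≥ q ^ τ` (`rpow_le_of_sub_lt`). So `γ` satisfies
`|p / q + γ / q ^ (τ + 1) - r / s| ≤ C' * s ^ (1/4 - τ)` for infinitely many `q`, with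
`p < q`, `s ≥ q ^ τ` and `0 < r / s - p / q ≤ q ^ (-τ-1)` (`mem_limsup_resonantSet`).

For given `q` these `γ` form a set of measure `O(q ^ (2 + τ * (5/2 - τ)))`
(`volume_resonantSet_le`). The exponent is less than `-1` for `τ ≥ 7 / 2`, which is below
`(3 + √17) / 2`, and the Borel–Cantelli lemma concludes.
-/

/-! ### Topology of the Diophantine sets -/

theorem mem_diophantineSet_iff {γ τ α : ℝ} :
    α ∈ diophantineSet γ τ ↔ α ∈ Ioo (0 : ℝ) 1 ∧
      ∀ q : ℕ, 1 ≤ q → ∀ p : ℤ, γ / (q : ℝ) ^ (τ + 1) ≤ |α - p / q| := by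
  have key : ∀ q : ℕ, 1 ≤ q → (γ / (q : ℝ) ^ τ ≤ distNearestInt (q * α) ↔
      ∀ p : ℤ, γ / (q : ℝ) ^ (τ + 1) ≤ |α - p / q|) := by
    intro q hq
    have hq0 : (0 : ℝ) < q := by exact_mod_cast hq
    have hbdd : BddBelow (range fun p : ℤ => |(q * α : ℝ) - p|) :=
      ⟨0, by rintro _ ⟨p, rfl⟩; exact abs_nonneg _⟩
    unfold distNearestInt
    rw [le_ciInf_iff hbdd]
    refine forall_congr' fun p => ?_
    have h1 : (q * α : ℝ) - p = q * (α - p / q) := by field_simp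
    rw [h1, abs_mul, abs_of_pos hq0, Real.rpow_add_one hq0.ne', ← div_div, div_le_iff₀' hq0]
  unfold diophantineSet
  simp only [mem_ofPred_eq]
  refine and_congr_right fun _ => ?_
  exact forall_congr' fun q => forall_congr' fun hq => key q hq

theorem one_sub_mem_diophantineSet {γ τ α : ℝ} (h : α ∈ diophantineSet γ τ) :
    1 - α ∈ diophantineSet γ τ := by
  rw [mem_diophantineSet_iff] at h ⊢
  refine ⟨⟨by linarith [h.1.2], by linarith [h.1.1]⟩, fun q hq p => ?_⟩
  have hq0 : (q : ℝ) ≠ 0 := by positivity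
  have h1 := h.2 q hq (q - p)
  rw [abs_sub_comm] at h1
  convert h1 using 2
  push_cast
  field_simp
  ring

theorem isClosed_diophantineSet {γ : ℝ} (hγ : 0 < γ) (τ : ℝ) :
    IsClosed (diophantineSet γ τ) := by
  have : diophantineSet γ τ = Icc (0 : ℝ) 1 ∩
      ⋂ q : ℕ, ⋂ _ : 1 ≤ q, ⋂ p : ℤ, {α : ℝ | γ / (q : ℝ) ^ (τ + 1) ≤ |α - p / q|} := by
    ext α
    rw [mem_diophantineSet_iff]
    simp only [mem_inter_iff, mem_iInter, mem_ofPred_eq]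
    refine and_congr_left fun h => ⟨fun h' => Ioo_subset_Icc_self h', fun h' => ?_⟩
    have h0 := h 1 le_rfl 0
    have h1 := h 1 le_rfl 1
    simp only [Nat.cast_one, Real.one_rpow, div_one, Int.cast_zero, Int.cast_one, sub_zero]
      at h0 h1
    refine ⟨h'.1.lt_of_ne ?_, h'.2.lt_of_ne ?_⟩
    · rintro rfl; simp at h0; linarith
    · rintro rfl; simp at h1; linarith
  rw [this]
  refine isClosed_Icc.inter (isClosed_iInter fun q => isClosed_iInter fun _ =>
    isClosed_iInter fun p => ?_)
  exact isClosed_le continuous_const (by fun_prop)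

theorem ratCast_notMem_diophantineSet {γ : ℝ} (hγ : 0 < γ) (τ : ℝ) (x : ℚ) :
    (x : ℝ) ∉ diophantineSet γ τ := by
  intro h
  have h1 := (mem_diophantineSet_iff.1 h).2 x.den x.pos x.num
  have hq0 : (0 : ℝ) < x.den := by exact_mod_cast x.pos
  rw [← Rat.cast_def, sub_self, abs_zero] at h1
  exact absurd h1 (not_le.2 (by positivity))

theorem isTotallyDisconnected_diophantineSet {γ : ℝ} (hγ : 0 < γ) (τ : ℝ) :
    IsTotallyDisconnected (diophantineSet γ τ) := by
  intro t ht hpre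
  have hne : ∀ x ∈ t, ∀ y ∈ t, ¬ x < y := by
    intro x hx y hy hxy
    obtain ⟨r, hr1, hr2⟩ := exists_rat_btwn hxy
    exact ratCast_notMem_diophantineSet hγ τ r
      (ht (hpre.ordConnected.out hx hy ⟨hr1.le, hr2.le⟩))
  intro x hx y hy
  exact le_antisymm (not_lt.1 (hne y hy x hx)) (not_lt.1 (hne x hx y hy))

theorem isCantorSet_diophantineSet {γ : ℝ} (hγ : 0 < γ) {τ : ℝ}
    (h : ¬ (isolatedPoints (diophantineSet γ τ)).Nonempty) :
    IsCantorSet (diophantineSet γ τ) := by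
  have hc := isClosed_diophantineSet hγ τ
  refine ⟨hc, isTotallyDisconnected_diophantineSet hγ τ, ?_⟩
  refine Subset.antisymm (isClosed_iff_derivedSet_subset _ |>.1 hc) fun x hx => ?_
  by_contra hacc
  rw [mem_derivedSet, accPt_iff_nhds] at hacc
  push Not at hacc
  obtain ⟨U, hU, hUx⟩ := hacc
  obtain ⟨V, hVU, hV, hxV⟩ := mem_nhds_iff.1 hU
  refine h ⟨x, hx, V, hV, Subset.antisymm (fun y hy => hUx y ⟨hVU hy.1, hy.2⟩) ?_⟩
  rintro _ rfl
  exact ⟨hxV, hx⟩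

theorem diophantineSet_eq_empty {γ : ℝ} (hγ : 1 / 2 ≤ γ) (τ : ℝ) :
    diophantineSet γ τ = ∅ := by
  refine eq_empty_of_forall_notMem fun α h => ?_
  have h' := (mem_diophantineSet_iff.1 h).2
  have hpos := (mem_diophantineSet_iff.1 h).1
  have h0 := h' 1 le_rfl 0
  have h1 := h' 1 le_rfl 1
  simp only [Nat.cast_one, Real.one_rpow, div_one, Int.cast_zero, Int.cast_one, sub_zero] at h0 h1
  rw [abs_of_pos hpos.1] at h0
  rw [abs_sub_comm, abs_of_pos (by linarith [hpos.2])] at h1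
  have : α = ((1 / 2 : ℚ) : ℝ) := by push_cast; linarith
  exact ratCast_notMem_diophantineSet (by linarith) τ _ (this ▸ h)

/-! ### Tails of the zeta series -/

/-- The value `ζ(5/4)`; the term at `0` of the series is `0`. -/
noncomputable def zetaFiveQuarters : ℝ := ∑' n : ℕ, (n : ℝ) ^ (-(5 / 4) : ℝ)

theorem summable_rpow_neg_five_quarters : Summable fun n : ℕ => (n : ℝ) ^ (-(5 / 4) : ℝ) :=
  Real.summable_nat_rpow.2 (by norm_num)

theorem zetaFiveQuarters_nonneg : 0 ≤ zetaFiveQuarters :=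
  tsum_nonneg fun _ => by positivity

/-- A tail of the series `∑ n ^ (-b)`, compared with `ζ(5/4)`: the exponent lost is `5/4`, a little
more than the optimal `1`. -/
theorem tsum_tail_rpow_le {x b : ℝ} (hx : 0 < x) (hb : 5 / 4 ≤ b) :
    ∑' n : ℕ, (if x ≤ n then ENNReal.ofReal ((n : ℝ) ^ (-b)) else 0) ≤
      ENNReal.ofReal (x ^ (5 / 4 - b) * zetaFiveQuarters) := by
  unfold zetaFiveQuarters
  rw [← tsum_mul_left, ENNReal.ofReal_tsum_of_nonneg (fun n => by positivity)
    (summable_rpow_neg_five_quarters.mul_left _)]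
  refine ENNReal.tsum_le_tsum fun n => ?_
  split_ifs with h
  · refine ENNReal.ofReal_le_ofReal ?_
    have hn : (0 : ℝ) < n := hx.trans_le h
    have : (n : ℝ) ^ (-b) = (n : ℝ) ^ (5 / 4 - b) * (n : ℝ) ^ (-(5 / 4) : ℝ) := by
      rw [← Real.rpow_add hn]; ring_nf
    rw [this]
    exact mul_le_mul_of_nonneg_right
      (Real.rpow_le_rpow_of_nonpos hx h (by linarith)) (by positivity)
  · exact zero_le

theorem card_Ioc_floor_le (x : ℝ) {y : ℝ} (hy : 0 ≤ y) :
    ((Finset.Ioc ⌊x⌋ ⌊x + y⌋).card : ℝ) ≤ y + 1 := by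
  rw [Int.card_Ioc]
  have h : ⌊x⌋ ≤ ⌊x + y⌋ := Int.floor_le_floor (by linarith)
  have h2 : (((⌊x + y⌋ - ⌊x⌋).toNat : ℤ) : ℝ) = ⌊x + y⌋ - ⌊x⌋ := by
    rw [Int.toNat_of_nonneg (by linarith)]; push_cast; ring
  rw [← Int.cast_natCast, h2]
  linarith [Int.floor_le (x + y), Int.lt_floor_add_one x]

/-! ### Resonant parameters -/

/-- The parameters `γ` for which the right endpoint of some interval with centre `p / q` lies within
`K * s ^ (1/4 - τ)` of some `r / s`, where `s ≥ q ^ τ` and `0 < r / s - p / q ≤ q ^ (-τ-1)`. -/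
def resonantSet (τ K : ℝ) (q : ℕ) : Set ℝ :=
  ⋃ p ∈ Finset.range q, ⋃ s : ℕ, ⋃ _ : (q : ℝ) ^ τ ≤ s,
    ⋃ r ∈ Finset.Ioc ⌊(s * (p / q) : ℝ)⌋ ⌊(s * (p / q) + s * (q : ℝ) ^ (-τ - 1) : ℝ)⌋,
      {γ : ℝ | |p / q + γ / (q : ℝ) ^ (τ + 1) - r / s| ≤ K * (s : ℝ) ^ (1 / 4 - τ)}

theorem volume_abs_affine_le {a c d m : ℝ} (hm : 0 < m) :
    volume {γ : ℝ | |a + γ / m - c| ≤ d} ≤ ENNReal.ofReal (2 * d * m) := by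
  have : {γ : ℝ | |a + γ / m - c| ≤ d} ⊆ Icc ((c - a - d) * m) ((c - a + d) * m) := by
    intro γ hγ
    have h := abs_le.1 (show |a + γ / m - c| ≤ d from hγ)
    constructor
    · rw [← le_div_iff₀ hm]; linarith
    · rw [← div_le_iff₀ hm]; linarith
  refine (measure_mono this).trans ?_
  rw [Real.volume_Icc]
  exact ENNReal.ofReal_le_ofReal (by linarith)

theorem volume_resonantSet_le {τ K : ℝ} (hτ : 5 / 2 ≤ τ) (hK : 0 ≤ K) {q : ℕ} (hq : 1 ≤ q) :
    volume (resonantSet τ K q) ≤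
      ENNReal.ofReal (4 * K * zetaFiveQuarters * (q : ℝ) ^ (2 + τ * (5 / 2 - τ))) := by
  have hq1 : (1 : ℝ) ≤ q := by exact_mod_cast hq
  have hq0 : (0 : ℝ) < q := by linarith
  have hx : (0 : ℝ) < (q : ℝ) ^ τ := by positivity
  have hbase : ∀ p : ℕ, ∀ s : ℕ,
      volume (⋃ _ : (q : ℝ) ^ τ ≤ s,
        ⋃ r ∈ Finset.Ioc ⌊(s * (p / q) : ℝ)⌋ ⌊(s * (p / q) + s * (q : ℝ) ^ (-τ - 1) : ℝ)⌋,
        {γ : ℝ | |p / q + γ / (q : ℝ) ^ (τ + 1) - r / s| ≤ K * (s : ℝ) ^ (1 / 4 - τ)}) ≤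
      ENNReal.ofReal (4 * K * q) *
        (if (q : ℝ) ^ τ ≤ s then ENNReal.ofReal ((s : ℝ) ^ (-(τ - 5 / 4))) else 0) := by
    intro p s
    split_ifs with hs
    swap
    · simp [hs]
    have hs0 : (0 : ℝ) < s := hx.trans_le hs
    simp only [hs, iUnion_true]
    refine (measure_biUnion_finset_le _ _).trans ?_
    refine (Finset.sum_le_card_nsmul _ _
      (ENNReal.ofReal (2 * (K * (s : ℝ) ^ (1 / 4 - τ)) * (q : ℝ) ^ (τ + 1)))
      fun r _ => volume_abs_affine_le (by positivity)).trans ?_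
    rw [nsmul_eq_mul, ← ENNReal.ofReal_natCast, ← ENNReal.ofReal_mul (by positivity),
      ← ENNReal.ofReal_mul (by positivity)]
    refine ENNReal.ofReal_le_ofReal ?_
    have hcard := card_Ioc_floor_le (s * (p / q) : ℝ)
      (y := s * (q : ℝ) ^ (-τ - 1)) (by positivity)
    -- since `s ≥ q ^ τ` and `q ≥ 1`, both terms of the count are at most `s * q ^ (-τ)`
    have hcard2 : s * (q : ℝ) ^ (-τ - 1) + 1 ≤ 2 * (s * (q : ℝ) ^ (-τ)) := by
      have h1 : (q : ℝ) ^ (-τ - 1) ≤ (q : ℝ) ^ (-τ) :=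
        Real.rpow_le_rpow_of_exponent_le hq1 (by linarith)
      have h2 : 1 ≤ s * (q : ℝ) ^ (-τ) := by
        rw [Real.rpow_neg hq0.le, ← div_eq_mul_inv, one_le_div hx]; exact hs
      nlinarith
    have e1 : (q : ℝ) ^ (τ + 1) = q ^ τ * q := by rw [Real.rpow_add_one hq0.ne']
    have e2 : (s : ℝ) ^ (-(τ - 5 / 4)) = s * (s : ℝ) ^ (1 / 4 - τ) := by
      rw [← Real.rpow_one_add' hs0.le (by linarith)]; ring_nf
    have e3 : (q : ℝ) ^ (-τ) * q ^ τ = 1 := by rw [← Real.rpow_add hq0]; simp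
    calc _ ≤ 2 * (s * (q : ℝ) ^ (-τ)) * (2 * (K * (s : ℝ) ^ (1 / 4 - τ)) * (q : ℝ) ^ (τ + 1)) :=
          mul_le_mul_of_nonneg_right (hcard.trans hcard2) (by positivity)
      _ = 4 * K * q * (s * (s : ℝ) ^ (1 / 4 - τ)) * ((q : ℝ) ^ (-τ) * q ^ τ) := by rw [e1]; ring
      _ = _ := by rw [e2, e3, mul_one]
  have hp : ∀ p : ℕ, volume (⋃ s : ℕ, ⋃ _ : (q : ℝ) ^ τ ≤ s,
        ⋃ r ∈ Finset.Ioc ⌊(s * (p / q) : ℝ)⌋ ⌊(s * (p / q) + s * (q : ℝ) ^ (-τ - 1) : ℝ)⌋,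
        {γ : ℝ | |p / q + γ / (q : ℝ) ^ (τ + 1) - r / s| ≤ K * (s : ℝ) ^ (1 / 4 - τ)}) ≤
      ENNReal.ofReal (4 * K * q * (((q : ℝ) ^ τ) ^ (5 / 2 - τ) * zetaFiveQuarters)) := by
    intro p
    refine (measure_iUnion_le _).trans ((ENNReal.tsum_le_tsum (hbase p)).trans ?_)
    rw [ENNReal.tsum_mul_left, ENNReal.ofReal_mul (p := 4 * K * q) (by positivity)]
    refine mul_le_mul_right ?_ _
    have h := tsum_tail_rpow_le hx (b := τ - 5 / 4) (by linarith)
    rwa [show (5 / 4 : ℝ) - (τ - 5 / 4) = 5 / 2 - τ by ring] at h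
  refine (measure_biUnion_finset_le _ _).trans
    ((Finset.sum_le_card_nsmul _ _ _ fun p _ => hp p).trans ?_)
  rw [Finset.card_range, nsmul_eq_mul, ← ENNReal.ofReal_natCast,
    ← ENNReal.ofReal_mul (by positivity), ← Real.rpow_mul hq0.le, Real.rpow_add hq0,
    Real.rpow_two]
  exact ENNReal.ofReal_le_ofReal (by apply le_of_eq; ring)

/-- The Borel–Cantelli step. -/
theorem volume_limsup_resonantSet {τ K : ℝ} (hτ : 7 / 2 ≤ τ) (hK : 0 ≤ K) :
    volume (limsup (resonantSet τ K) atTop) = 0 := by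
  refine measure_limsup_atTop_eq_zero (ne_top_of_le_ne_top ?_ (ENNReal.tsum_le_tsum
    (g := fun q : ℕ => ENNReal.ofReal
      (4 * K * zetaFiveQuarters * (q : ℝ) ^ (2 + τ * (5 / 2 - τ)))) fun q => ?_))
  · have hs : Summable fun q : ℕ => 4 * K * zetaFiveQuarters * (q : ℝ) ^ (2 + τ * (5 / 2 - τ)) :=
      (Real.summable_nat_rpow.2 (by nlinarith)).mul_left _
    have hZ := zetaFiveQuarters_nonneg
    rw [← ENNReal.ofReal_tsum_of_nonneg (fun n => by positivity) hs]
    exact ENNReal.ofReal_ne_top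
  · rcases Nat.eq_zero_or_pos q with rfl | hq
    · simp [resonantSet]
    · exact volume_resonantSet_le (by linarith) hK hq

/-! ### Records and gaps -/

/-- Two consecutive records of a sequence that accumulates at its strict upper bound `α`, beyond any
given index `N`. -/
theorem exists_consecutive_records {e : ℕ → ℝ} {α : ℝ} (h : ∀ n, e n < α)
    (h' : ∀ x < α, ∃ n, x < e n) (N : ℕ) :
    ∃ q s, N < q ∧ q < s ∧ e q < e s ∧ ∀ n < s, e n ≤ e q := by
  classical
  obtain ⟨m, -, hm⟩ := Finset.exists_max_image (Finset.range (N + 1)) e ⟨0, by simp⟩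
  have hq := h' (e m) (h m)
  have hqs := Nat.find_spec hq
  have hqm : ∀ n < Nat.find hq, e n ≤ e m := fun n hn => not_lt.1 (Nat.find_min hq hn)
  generalize Nat.find hq = q at hqs hqm
  have hs := h' (e q) (h q)
  have hss := Nat.find_spec hs
  have hsm : ∀ n < Nat.find hs, e n ≤ e q := fun n hn => not_lt.1 (Nat.find_min hs hn)
  generalize Nat.find hs = s at hss hsm
  refine ⟨q, s, ?_, ?_, hss, hsm⟩
  · by_contra hle
    exact absurd hqs (not_lt.2 (hm q (by simp; omega)))
  · by_contra hle
    rcases (not_lt.1 hle).eq_or_lt with h1 | h1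
    · rw [h1] at hss; exact lt_irrefl _ hss
    · exact absurd ((hqm s h1).trans_lt hqs) (not_lt.2 hss.le)

/-- If the intervals of radius `γ / n ^ (τ + 1)` with centres `p / n < α` and denominators
`n ≥ s` cover `(a, α)`, then `α - a` is at most the total length of those that meet `(a, α)`: for
each `n` there are at most `n * (α - a) + 2` of them. -/
theorem ofReal_gap_le_tsum {γ τ a α : ℝ} {s : ℕ} (hγ : 0 < γ) (hγ2 : γ < 1 / 2) (hτ : 0 ≤ τ)
    (hs : 1 ≤ s) (ha : a ≤ α)
    (hcov : ∀ x ∈ Ioo a α, ∃ n : ℕ, s ≤ n ∧ ∃ p : ℤ, (p / n : ℝ) < α ∧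
      |x - p / n| < γ / (n : ℝ) ^ (τ + 1)) :
    ENNReal.ofReal (α - a) ≤ ∑' n : ℕ, (if (s : ℝ) ≤ n then
      ENNReal.ofReal ((n * (α - a) + 2) * (n : ℝ) ^ (-(τ + 1))) else 0) := by
  have hsub : Ioo a α ⊆ ⋃ n : ℕ, ⋃ _ : s ≤ n,
      ⋃ p ∈ Finset.Ioc ⌊(n * a - 1 : ℝ)⌋ ⌊(n * a - 1 + (n * (α - a) + 1) : ℝ)⌋,
        Metric.ball (p / n : ℝ) (γ / (n : ℝ) ^ (τ + 1)) := by
    intro x hx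
    obtain ⟨n, hn, p, hp, hxp⟩ := hcov x hx
    have hn1 : (1 : ℝ) ≤ n := by exact_mod_cast hs.trans hn
    have hn0 : (0 : ℝ) < n := by linarith
    simp only [mem_iUnion, exists_prop]
    refine ⟨n, hn, p, ?_, by rwa [Metric.mem_ball, Real.dist_eq]⟩
    rw [Finset.mem_Ioc, Int.floor_lt, Int.le_floor]
    have h1 : n * (γ / (n : ℝ) ^ (τ + 1)) ≤ 1 := by
      rw [Real.rpow_add_one hn0.ne', ← mul_div_assoc, div_le_one (by positivity), mul_comm]
      have := Real.one_le_rpow hn1 hτ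
      nlinarith
    have h2 : (p : ℝ) = n * (p / n) := by field_simp
    have h3 := (abs_lt.1 hxp).2
    rw [h2]
    constructor <;> nlinarith [hx.1]
  rw [← Real.volume_Ioo]
  refine (measure_mono hsub).trans ((measure_iUnion_le _).trans (ENNReal.tsum_le_tsum fun n => ?_))
  by_cases hn : s ≤ n
  swap
  · simp [hn]
  have hn1 : (1 : ℝ) ≤ n := by exact_mod_cast hs.trans hn
  have hn0 : (0 : ℝ) < n := by linarith
  have hαa : 0 ≤ α - a := by linarith
  simp only [hn, iUnion_true, Nat.cast_le, if_true]
  refine (measure_biUnion_finset_le _ _).trans ?_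
  refine (Finset.sum_le_card_nsmul _ _ (ENNReal.ofReal ((n : ℝ) ^ (-(τ + 1))))
    fun p _ => ?_).trans ?_
  · rw [Real.volume_ball, Real.rpow_neg hn0.le]
    refine ENNReal.ofReal_le_ofReal ?_
    rw [← mul_div_assoc, div_eq_mul_inv]
    exact mul_le_of_le_one_left (by positivity) (by linarith)
  · rw [nsmul_eq_mul, ← ENNReal.ofReal_natCast, ← ENNReal.ofReal_mul (by positivity)]
    refine ENNReal.ofReal_le_ofReal (mul_le_mul_of_nonneg_right ?_ (by positivity))
    have := card_Ioc_floor_le (n * a - 1 : ℝ) (y := n * (α - a) + 1) (by positivity)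
    linarith

theorem gap_le {γ τ a α : ℝ} {s : ℕ} (hγ : 0 < γ) (hγ2 : γ < 1 / 2) (hτ : 5 / 4 ≤ τ)
    (hs : 1 ≤ s) (ha : a ≤ α)
    (hZ : zetaFiveQuarters * (s : ℝ) ^ (5 / 4 - τ) ≤ 1 / 2)
    (hcov : ∀ x ∈ Ioo a α, ∃ n : ℕ, s ≤ n ∧ ∃ p : ℤ, (p / n : ℝ) < α ∧
      |x - p / n| < γ / (n : ℝ) ^ (τ + 1)) :
    α - a ≤ 4 * zetaFiveQuarters * (s : ℝ) ^ (1 / 4 - τ) := by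
  have hs0 : (0 : ℝ) < s := by exact_mod_cast hs
  have hαa : 0 ≤ α - a := by linarith
  have hz := zetaFiveQuarters_nonneg
  have h := ofReal_gap_le_tsum hγ hγ2 (by linarith) hs ha hcov
  have hsplit : ∀ n : ℕ, (if (s : ℝ) ≤ n then
      ENNReal.ofReal ((n * (α - a) + 2) * (n : ℝ) ^ (-(τ + 1))) else 0) =
      ENNReal.ofReal (α - a) * (if (s : ℝ) ≤ n then ENNReal.ofReal ((n : ℝ) ^ (-τ)) else 0) +
      ENNReal.ofReal 2 * (if (s : ℝ) ≤ n then ENNReal.ofReal ((n : ℝ) ^ (-(τ + 1))) else 0) := by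
    intro n
    split_ifs with hn
    · have hn0 : (0 : ℝ) < n := hs0.trans_le hn
      rw [← ENNReal.ofReal_mul hαa, ← ENNReal.ofReal_mul (by norm_num),
        ← ENNReal.ofReal_add (by positivity) (by positivity)]
      congr 1
      have : (n : ℝ) ^ (-τ) = n * (n : ℝ) ^ (-(τ + 1)) := by
        rw [← Real.rpow_one_add' hn0.le (by linarith)]; ring_nf
      rw [this]; ring
    · simp
  rw [tsum_congr hsplit, ENNReal.tsum_add, ENNReal.tsum_mul_left, ENNReal.tsum_mul_left] at h
  have h2 := h.trans (add_le_add
    (mul_le_mul_right (tsum_tail_rpow_le hs0 hτ) _)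
    (mul_le_mul_right (tsum_tail_rpow_le hs0 (b := τ + 1) (by linarith)) _))
  rw [← ENNReal.ofReal_mul hαa, ← ENNReal.ofReal_mul (by norm_num),
    ← ENNReal.ofReal_add (by positivity) (by positivity),
    ENNReal.ofReal_le_ofReal_iff (by positivity)] at h2
  rw [show (5 / 4 : ℝ) - (τ + 1) = 1 / 4 - τ by ring] at h2
  nlinarith

/-! ### Points isolated on one side -/

/-- `⌊qα⌋ / q + γ / q ^ (τ + 1)`: among the intervals centred at the fractions below `α` with
denominator `q`, the right endpoint closest to `α`. For `q = 0` it takes the junk value `0`. -/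
noncomputable def rightEnd (γ τ α : ℝ) (q : ℕ) : ℝ :=
  ⌊q * α⌋ / q + γ / (q : ℝ) ^ (τ + 1)

theorem le_rightEnd {γ τ α : ℝ} {p : ℤ} {q : ℕ} (hq : 1 ≤ q) (hp : (p / q : ℝ) < α) :
    p / q + γ / (q : ℝ) ^ (τ + 1) ≤ rightEnd γ τ α q := by
  have hq0 : (0 : ℝ) < q := by exact_mod_cast hq
  have : p ≤ ⌊q * α⌋ := by
    rw [Int.le_floor]
    rw [div_lt_iff₀ hq0] at hp
    linarith
  have h2 : (p : ℝ) ≤ ⌊q * α⌋ := by exact_mod_cast this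
  unfold rightEnd
  gcongr

theorem rightEnd_lt {γ τ α : ℝ} (hτ : 0 ≤ τ) (hα : α ∈ diophantineSet γ τ)
    (hne : ∀ (p : ℤ) (q : ℕ), 1 ≤ q → p / q + γ / (q : ℝ) ^ (τ + 1) ≠ α) (q : ℕ) :
    rightEnd γ τ α q < α := by
  rw [mem_diophantineSet_iff] at hα
  rcases Nat.eq_zero_or_pos q with rfl | hq
  · have : (0 : ℝ) ^ (τ + 1) = 0 := Real.zero_rpow (by linarith)
    simpa [rightEnd, this] using hα.1.1
  · have hq0 : (0 : ℝ) < q := by exact_mod_cast hq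
    refine lt_of_le_of_ne ?_ (hne _ q hq)
    have h1 := hα.2 q hq ⌊q * α⌋
    have h2 : (⌊q * α⌋ / q : ℝ) ≤ α := by
      rw [div_le_iff₀ hq0, mul_comm α]; exact Int.floor_le _
    rw [abs_of_nonneg (by linarith)] at h1
    unfold rightEnd
    linarith

/-- A point just below `α` outside the Diophantine set lies in an interval centred below `α`, since
an interval centred above `α` cannot reach across `α`. -/
theorem exists_covering_of_notMem {γ τ α x : ℝ} (hα : α ∈ diophantineSet γ τ)
    (hx0 : 0 < x) (hxα : x < α) (hx : x ∉ diophantineSet γ τ) :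
    ∃ n : ℕ, 1 ≤ n ∧ ∃ p : ℤ, (p / n : ℝ) < α ∧ |x - p / n| < γ / (n : ℝ) ^ (τ + 1) := by
  rw [mem_diophantineSet_iff] at hα hx
  push Not at hx
  obtain ⟨n, hn, p, hp⟩ := hx ⟨hx0, hxα.trans hα.1.2⟩
  refine ⟨n, hn, p, ?_, hp⟩
  by_contra! hle
  have h1 := hα.2 n hn p
  rw [abs_of_nonpos (by linarith)] at h1
  have := (abs_lt.1 hp).1
  linarith

theorem eventually_const_mul_rpow_le (c : ℝ) {b : ℝ} (hb : b < 0) :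
    ∀ᶠ n : ℕ in atTop, c * (n : ℝ) ^ b ≤ 1 := by
  have h := ((tendsto_rpow_neg_atTop (y := -b) (by linarith)).comp
    tendsto_natCast_atTop_atTop).const_mul c
  rw [mul_zero] at h
  filter_upwards [h.eventually (gt_mem_nhds one_pos)] with n hn
  simpa using hn.le

/-- Distinct fractions with denominators `q < s` are at least `1 / (q * s)` apart. If `δ` exceeded
`γ / q ^ (τ + 1)`, this would contradict the bound on `δ`; hence `γ / q ^ (τ + 1)` dominates, which
makes the fractions close and `s` at least `q ^ τ`. -/
theorem rpow_le_of_sub_lt {γ τ δ : ℝ} {q s : ℕ} {p r : ℤ} (hγ2 : γ < 1 / 2)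
    (hq : 1 ≤ q) (hqs : q < s) (hlt : (p / q : ℝ) < r / s)
    (hδ : δ ≤ 4 * zetaFiveQuarters * (s : ℝ) ^ (1 / 4 - τ))
    (hs : 8 * zetaFiveQuarters * (s : ℝ) ^ (9 / 4 - τ) ≤ 1)
    (hd : (r / s - p / q : ℝ) < γ / (q : ℝ) ^ (τ + 1) + δ) :
    (q : ℝ) ^ τ ≤ s ∧ (r / s - p / q : ℝ) ≤ (q : ℝ) ^ (-τ - 1) := by
  have hq0 : (0 : ℝ) < q := by exact_mod_cast hq
  have hqs' : (q : ℝ) < s := by exact_mod_cast hqs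
  have hs0 : (0 : ℝ) < s := hq0.trans hqs'
  have hz := zetaFiveQuarters_nonneg
  have hsep : 1 / (q * s : ℝ) ≤ r / s - p / q := by
    rw [div_lt_div_iff₀ hq0 hs0] at hlt
    have h1 : p * s < r * q := by exact_mod_cast hlt
    have h2 : (p * s + 1 : ℝ) ≤ r * q := by exact_mod_cast h1
    rw [div_sub_div _ _ hs0.ne' hq0.ne', mul_comm (q : ℝ)]
    gcongr
    linarith
  have hδγ : δ ≤ γ / (q : ℝ) ^ (τ + 1) := by
    by_contra! hlt'
    have h1 : 1 / (q * s : ℝ) < 2 * (4 * zetaFiveQuarters * (s : ℝ) ^ (1 / 4 - τ)) := by linarith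
    rw [div_lt_iff₀ (by positivity)] at h1
    have h2 : (s : ℝ) ^ (9 / 4 - τ) = (s : ℝ) ^ (1 / 4 - τ) * s * s := by
      rw [mul_assoc, ← sq, ← Real.rpow_two, ← Real.rpow_add hs0]; ring_nf
    rw [h2] at hs
    have h3 : 8 * zetaFiveQuarters * (s : ℝ) ^ (1 / 4 - τ) * s * q ≤
        8 * zetaFiveQuarters * (s : ℝ) ^ (1 / 4 - τ) * s * s := by gcongr
    nlinarith
  have hmain : (r / s - p / q : ℝ) ≤ (q : ℝ) ^ (-τ - 1) := by
    have : γ / (q : ℝ) ^ (τ + 1) ≤ 1 / 2 * (q : ℝ) ^ (-τ - 1) := by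
      rw [show -τ - 1 = -(τ + 1) by ring, Real.rpow_neg hq0.le, div_eq_mul_inv]
      gcongr
    linarith
  refine ⟨?_, hmain⟩
  have h1 := hsep.trans hmain
  rw [show -τ - 1 = -(τ + 1) by ring, Real.rpow_neg hq0.le, ← one_div,
    one_div_le_one_div (by positivity) (by positivity), Real.rpow_add_one hq0.ne', mul_comm] at h1
  exact le_of_mul_le_mul_left h1 hq0

/-- A point of the Diophantine set that is isolated from the left, but is not the right endpoint of
an interval, forces `γ` into infinitely many resonant sets. -/
theorem mem_limsup_resonantSet {γ τ α ε : ℝ} (hγ : 0 < γ) (hγ2 : γ < 1 / 2) (hτ : 7 / 2 ≤ τ)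
    (hα : α ∈ diophantineSet γ τ)
    (hne : ∀ (p : ℤ) (q : ℕ), 1 ≤ q → p / q + γ / (q : ℝ) ^ (τ + 1) ≠ α) (hε : 0 < ε)
    (hgap : ∀ x ∈ Ioo (α - ε) α, x ∉ diophantineSet γ τ) :
    γ ∈ limsup (resonantSet τ (4 * zetaFiveQuarters + 1)) atTop := by
  rw [mem_limsup_iff_frequently_mem, frequently_atTop']
  intro N
  have hα0 := (mem_diophantineSet_iff.1 hα).1
  have hz := zetaFiveQuarters_nonneg
  have hlt := rightEnd_lt (by linarith) hα hne
  have hcover : ∀ x < α, α - ε < x → 0 < x → ∃ n : ℕ, 1 ≤ n ∧ ∃ p : ℤ, (p / n : ℝ) < α ∧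
      |x - p / n| < γ / (n : ℝ) ^ (τ + 1) := fun x h1 h2 h3 =>
    exists_covering_of_notMem hα h3 h1 (hgap x ⟨h2, h1⟩)
  have happroach : ∀ x < α, ∃ n, x < rightEnd γ τ α n := by
    intro x hx
    obtain ⟨y, hy1, hy2⟩ := exists_between (max_lt hx (max_lt (sub_lt_self α hε) hα0.1))
    simp only [max_lt_iff] at hy1
    obtain ⟨n, hn, p, hp, hyp⟩ := hcover y hy2 hy1.2.1 hy1.2.2
    exact ⟨n, by linarith [le_rightEnd (γ := γ) (τ := τ) hn hp, (abs_lt.1 hyp).2]⟩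
  obtain ⟨n₀, hn₀⟩ := happroach (max (α - ε) 0) (max_lt (sub_lt_self α hε) hα0.1)
  rw [max_lt_iff] at hn₀
  obtain ⟨N₁, hN₁⟩ := eventually_atTop.1
    (eventually_const_mul_rpow_le (8 * zetaFiveQuarters) (b := 9 / 4 - τ) (by linarith))
  obtain ⟨q, s, hNq, hqs, hes, hrec⟩ :=
    exists_consecutive_records hlt happroach (max N (max n₀ N₁))
  simp only [max_lt_iff] at hNq
  have hq : 1 ≤ q := by omega
  have hs1 : 1 ≤ s := by omega
  have hq0 : (0 : ℝ) < q := by exact_mod_cast hq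
  have hs0 : (0 : ℝ) < s := by exact_mod_cast hs1
  have hs1' : (1 : ℝ) ≤ s := by exact_mod_cast hs1
  have hsN := hN₁ s (by omega)
  have heq := hrec n₀ (by omega)
  -- the fractions of denominator less than `s` no longer contribute beyond the record at `q`
  have hδ : α - rightEnd γ τ α q ≤ 4 * zetaFiveQuarters * (s : ℝ) ^ (1 / 4 - τ) := by
    refine gap_le hγ hγ2 (by linarith) hs1 (hlt q).le ?_ ?_
    · have : (s : ℝ) ^ (5 / 4 - τ) ≤ (s : ℝ) ^ (9 / 4 - τ) :=
        Real.rpow_le_rpow_of_exponent_le hs1' (by linarith)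
      nlinarith [mul_le_mul_of_nonneg_left this hz]
    · intro x hx
      obtain ⟨n, hn, p, hp, hxp⟩ := hcover x hx.2 (by linarith [hx.1]) (by linarith [hx.1])
      refine ⟨n, ?_, p, hp, hxp⟩
      by_contra! hns
      have := hrec n hns
      linarith [le_rightEnd (γ := γ) (τ := τ) hn hp, (abs_lt.1 hxp).2, hx.1]
  have hrad : γ / (s : ℝ) ^ (τ + 1) < γ / (q : ℝ) ^ (τ + 1) := by
    have : (q : ℝ) ^ (τ + 1) < (s : ℝ) ^ (τ + 1) :=
      Real.rpow_lt_rpow hq0.le (by exact_mod_cast hqs) (by linarith)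
    gcongr
  have hrad0 : 0 < γ / (s : ℝ) ^ (τ + 1) := by positivity
  have hltq := hlt q
  have hlts := hlt s
  unfold rightEnd at hes hδ hltq hlts
  have hpr : (⌊q * α⌋ / q : ℝ) < ⌊s * α⌋ / s := by linarith
  obtain ⟨hqτ, hdist⟩ := rpow_le_of_sub_lt hγ2 hq hqs hpr hδ hsN (by linarith)
  refine ⟨q, hNq.1, ?_⟩
  have hp0 : 0 ≤ ⌊q * α⌋ := Int.floor_nonneg.2 (by have := hα0.1; positivity)
  have hpq : ⌊q * α⌋ < q := by
    rw [Int.floor_lt]; push_cast; nlinarith [hα0.2]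
  obtain ⟨p, hp⟩ := Int.eq_ofNat_of_zero_le hp0
  have hpR : ((⌊q * α⌋ : ℤ) : ℝ) = p := by rw [hp]; simp
  rw [hpR] at hpr hdist hes hδ hltq
  simp only [resonantSet, mem_iUnion, exists_prop, Finset.mem_range]
  refine ⟨p, by omega, s, hqτ, ⌊s * α⌋, ?_, ?_⟩
  · have h1 : (⌊s * α⌋ : ℝ) = s * (⌊s * α⌋ / s) := by field_simp
    rw [Finset.mem_Ioc, Int.floor_lt, Int.le_floor, h1]
    constructor <;> nlinarith
  · rw [mem_ofPred_eq]
    have hrad2 : γ / (s : ℝ) ^ (τ + 1) ≤ (s : ℝ) ^ (1 / 4 - τ) := by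
      calc γ / (s : ℝ) ^ (τ + 1) ≤ 1 / (s : ℝ) ^ (τ + 1) := by gcongr; linarith
        _ = (s : ℝ) ^ (-(τ + 1)) := by rw [Real.rpow_neg hs0.le, one_div]
        _ ≤ _ := Real.rpow_le_rpow_of_exponent_le hs1' (by linarith)
    have h0 : 0 ≤ 4 * zetaFiveQuarters * (s : ℝ) ^ (1 / 4 - τ) := by positivity
    rw [abs_le]
    constructor <;> linarith

/-! ### The measure of the exceptional parameters -/

/-- The parameters for which the right endpoint of one interval is the left endpoint of another. -/
def touchingSet (τ : ℝ) : Set ℝ :=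
  {γ | ∃ (p : ℤ) (q : ℕ) (p' : ℤ) (q' : ℕ), 1 ≤ q ∧ 1 ≤ q' ∧
    p / q + γ / (q : ℝ) ^ (τ + 1) = p' / q' - γ / (q' : ℝ) ^ (τ + 1)}

theorem countable_touchingSet (τ : ℝ) : (touchingSet τ).Countable := by
  have : touchingSet τ ⊆ range fun v : (ℤ × ℕ) × (ℤ × ℕ) =>
      (v.2.1 / v.2.2 - v.1.1 / v.1.2 : ℝ) /
        (1 / (v.1.2 : ℝ) ^ (τ + 1) + 1 / (v.2.2 : ℝ) ^ (τ + 1)) := by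
    rintro γ ⟨p, q, p', q', hq, hq', h⟩
    have hq0 : (0 : ℝ) < q := by exact_mod_cast hq
    have hq0' : (0 : ℝ) < q' := by exact_mod_cast hq'
    refine ⟨((p, q), (p', q')), ?_⟩
    simp only
    rw [div_eq_iff (by positivity)]
    rw [mul_add, mul_one_div, mul_one_div]
    linarith
  exact (countable_range _).mono this

/-- The reflection `α ↦ 1 - α` exchanges the two sides of an isolated point, so that
`mem_limsup_resonantSet` settles every isolated point that is not an endpoint on both sides. -/
theorem mem_of_nonempty_isolatedPoints {γ τ : ℝ} (hγ : 0 < γ) (hτ : 7 / 2 ≤ τ)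
    (h : (isolatedPoints (diophantineSet γ τ)).Nonempty) :
    γ ∈ touchingSet τ ∪ limsup (resonantSet τ (4 * zetaFiveQuarters + 1)) atTop := by
  obtain ⟨α, hα, U, hU, hUα⟩ := h
  have hγ2 : γ < 1 / 2 := by
    by_contra! hle
    rw [diophantineSet_eq_empty hle] at hα
    exact hα
  obtain ⟨ε, hε, hball⟩ := Metric.isOpen_iff.1 hU α (hUα.symm.subset rfl).1
  have hiso : ∀ x, |x - α| < ε → x ∈ diophantineSet γ τ → x = α := fun x hx hxD =>
    hUα.subset ⟨hball (by rwa [Metric.mem_ball, Real.dist_eq]), hxD⟩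
  by_cases hl : ∀ (p : ℤ) (q : ℕ), 1 ≤ q → p / q + γ / (q : ℝ) ^ (τ + 1) ≠ α
  · refine Or.inr (mem_limsup_resonantSet hγ hγ2 hτ hα hl hε fun x hx hxD => hx.2.ne ?_)
    exact hiso x (abs_lt.2 ⟨by linarith [hx.1], by linarith [hx.2]⟩) hxD
  by_cases hr : ∀ (p : ℤ) (q : ℕ), 1 ≤ q → p / q - γ / (q : ℝ) ^ (τ + 1) ≠ α
  · refine Or.inr (mem_limsup_resonantSet hγ hγ2 hτ (one_sub_mem_diophantineSet hα) ?_ hε ?_)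
    · intro p q hq heq
      refine hr (q - p) q hq ?_
      have hq0 : (q : ℝ) ≠ 0 := by positivity
      push_cast
      rw [sub_div, div_self hq0]
      linarith
    · intro x hx hxD
      have := hiso (1 - x) (abs_lt.2 ⟨by linarith [hx.2], by linarith [hx.1]⟩)
        (one_sub_mem_diophantineSet hxD)
      linarith [hx.2]
  push Not at hl hr
  obtain ⟨p, q, hq, h1⟩ := hl
  obtain ⟨p', q', hq', h2⟩ := hr
  exact Or.inl ⟨p, q, p', q', hq, hq', h1.trans h2.symm⟩

theorem mainTheorem1 (τ : ℝ) (hτ : (3 + Real.sqrt 17) / 2 < τ) :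
    (∀ᵐ γ : ℝ ∂(volume : Measure ℝ), 0 < γ → IsCantorSet (diophantineSet γ τ)) ∧
      volume {γ : ℝ | 0 < γ ∧ (isolatedPoints (diophantineSet γ τ)).Nonempty} = 0 := by
  -- all that is used of the lower bound on `τ` is `7 / 2 ≤ τ`
  have hτ' : 7 / 2 ≤ τ := by
    have : (4 : ℝ) ≤ Real.sqrt 17 := Real.le_sqrt_of_sq_le (by norm_num)
    linarith
  have hnull : volume {γ : ℝ | 0 < γ ∧ (isolatedPoints (diophantineSet γ τ)).Nonempty} = 0 := by
    refine measure_mono_null (fun γ hγ => mem_of_nonempty_isolatedPoints hγ.1 hτ' hγ.2)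
      (measure_union_null ((countable_touchingSet τ).measure_zero _) ?_)
    exact volume_limsup_resonantSet hτ' (by linarith [zetaFiveQuarters_nonneg])
  refine ⟨?_, hnull⟩
  filter_upwards [measure_eq_zero_iff_ae_notMem.1 hnull] with γ hγ hγ0
  exact isCantorSet_diophantineSet hγ0 fun h => hγ ⟨hγ0, h⟩
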